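/- All digraphs are finite, non-empty and simple (no loops, no parallel edges; opposite edges are allowed). A *directed tree* is a finite digraph with a root from which each node is reached by exactly one directed walk. A set $S$ of vertices is *strongly connected* if it is non-empty and induces a strongly connected subgraph. A *D-decomposition* of a digraph $G$ is a directed tree $T$ with sets $X_t\subseteq V(G)$ ($t\in V(T)$) such that $\bigcup_t X_t=V(G)$ and, for every strongly connected set $S\subseteq V(G)$, the nodes $t$ with $X_t\cap S\neq\emptyset$ induce a connected subtree of the underlying undirected tree of $T$. Its width is $\max_t|X_t|$, and the *D-width* $\mathrm{DW}(G)$ is the minimum width of a D-decomposition of $G$. For $Z\subseteq V(G)$, a set $S\subseteq V(G)\setminus Z$ is *$Z$-normal* if no directed walk in $G-Z$ that starts and ends in $S$ uses a vertex outside $S$. An *arboreal decomposition* of $G$ is a directed tree $T$ with a partition of $V(G)$ into non-empty sets $W_t$ ($t\in V(T)$) and with sets $X_e\subseteq V(G)$ ($e\in E(T)$) such that for each edge $e=(s,t)$ the union of the sets $W_q$ over all nodes $q$ reachable from $t$ (including $t$) is $X_e$-normal. Its width is $\max_t\bigl|W_t\cup\bigcup_{e\sim t}X_e\bigr|-1$,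 where $e\sim t$ means that $e$ is incident with $t$; the *directed tree width* $\mathrm{dtw}(G)$ is the minimum width of an arboreal decomposition of $G$. **Theorem.** There is a class $\mathcal G$ of digraphs with bounded directed tree width but unbounded D-width: there is a number $c$ with $\mathrm{dtw}(G)\le c$ for all $G\in\mathcal G$, and for every $k$ there is $G\in\mathcal G$ with $\mathrm{DW}(G)>k$. Consequently there is no function $f:\mathbb N\to\mathbb N$ with $\mathrm{DW}(G)\le f(\mathrm{dtw}(G))$ for all digraphs $G$, and there is a digraph $G$ with $\mathrm{DW}(G)-1>\mathrm{dtw}(G)$; so D-width (with either normalisation, $\max_t|X_t|$ or $\max_t|X_t|-1$) and directed tree width are not equal, contrary to a conjecture of Safari. -/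

import Mathlib

/-- A finite, non-empty, simple digraph: no loops and no parallel edges, but pairs of opposite
edges are allowed. -/
structure FinDigraph where
  V : Type
  finite : Finite V
  nonempty : Nonempty V
  graph : Digraph V
  loopless : ∀ v, ¬ graph.Adj v v

namespace DigraphWidth

open Set Relation

/-- `w` is reachable from `v` by a directed path all of whose vertices lie in `S`
(for `v ∈ S`), that is, a directed path of the induced subgraph on `S`. -/
def ReachIn {V : Type*} (G : Digraph V) (S : Set V) (v w : V) : Prop :=
  ReflTransGen (fun a b => G.Adj a b ∧ a ∈ S ∧ b ∈ S) v w

/-- A (non-empty) set of vertices whose induced subgraph is strongly connected. -/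
def StronglyConnectedSet {V : Type*} (G : Digraph V) (S : Set V) : Prop :=
  S.Nonempty ∧ ∀ v ∈ S, ∀ w ∈ S, ReachIn G S v w

/-- A directed tree with all edges oriented away from the root `r`: the root has no incoming
edge, every node has at most one incoming edge, and every node is reachable from the root.
Equivalently, there is exactly one directed walk from `r` to each node. -/
structure IsArborescence {T : Type*} (A : Digraph T) (r : T) : Prop where
  root_source : ∀ s, ¬ A.Adj s r
  parent_unique : ∀ s s' t, A.Adj s t → A.Adj s' t → s = s'
  reachable : ∀ t, ReflTransGen A.Adj r t

/-! ### D-width -/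

/-- A D-decomposition of `G` with (finite) set of nodes `T`. -/
structure DDecomposition {V : Type*} (G : Digraph V) (T : Type*) where
  tree : Digraph T
  root : T
  isArborescence : IsArborescence tree root
  bag : T → Set V
  cover : (⋃ t, bag t) = univ
  /-- For a strongly connected set `S`, the nodes whose bags meet `S` induce a connected subtree of
  the underlying undirected tree. -/
  connected : ∀ S, StronglyConnectedSet G S →
    (tree.toSimpleGraphInclusive.induce {t | (bag t ∩ S).Nonempty}).Connected

/-- There is a D-decomposition of `G` all of whose bags have at most `k` vertices. -/
def HasDDecompositionOfWidth {V : Type*} (G : Digraph V) (k : ℕ) : Prop :=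
  ∃ (T : Type) (_ : Finite T) (D : DDecomposition G T), ∀ t, (D.bag t).ncard ≤ k

/-- The D-width of `G`: the minimum over all D-decompositions of the maximum size of a bag. -/
noncomputable def dWidth (G : FinDigraph) : ℕ :=
  sInf {k | HasDDecompositionOfWidth G.graph k}

/-! ### Directed tree width -/

/-- `S` is `Z`-normal: `S` is disjoint from `Z`, and no directed walk in `G - Z` that starts and
ends in `S` uses a vertex outside `S`. -/
def IsNormal {V : Type*} (G : Digraph V) (Z S : Set V) : Prop :=
  Disjoint S Z ∧
    ∀ u ∈ S, ∀ w ∈ S, ∀ v ∉ Z, ReachIn G Zᶜ u v → ReachIn G Zᶜ v w → v ∈ S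

/-- An arboreal decomposition (directed tree decomposition) of `G` with (finite) set of nodes `T`.
The set `guard s t` is only meaningful if `(s, t)` is an edge of the tree. -/
structure ArborealDecomposition {V : Type*} (G : Digraph V) (T : Type*) where
  tree : Digraph T
  root : T
  isArborescence : IsArborescence tree root
  bag : T → Set V
  guard : T → T → Set V
  bag_nonempty : ∀ t, (bag t).Nonempty
  bag_disjoint : Pairwise fun s t => Disjoint (bag s) (bag t)
  cover : (⋃ t, bag t) = univ
  /-- For each tree edge, the union of the bags below it is normal for the guard of that edge. -/
  normal : ∀ s t, tree.Adj s t →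
    IsNormal G (guard s t) (⋃ q ∈ {q | ReflTransGen tree.Adj t q}, bag q)

/-- The bag of `t` together with the guards of all tree edges incident with `t`. -/
def ArborealDecomposition.fullBag {V : Type*} {G : Digraph V} {T : Type*}
    (D : ArborealDecomposition G T) (t : T) : Set V :=
  D.bag t ∪ (⋃ s ∈ {s | D.tree.Adj s t}, D.guard s t) ∪ ⋃ q ∈ {q | D.tree.Adj t q}, D.guard t q

/-- There is an arboreal decomposition of `G` of width at most `k`. -/
def HasArborealDecompositionOfWidth {V : Type*} (G : Digraph V) (k : ℕ) : Prop :=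
  ∃ (T : Type) (_ : Finite T) (D : ArborealDecomposition G T), ∀ t, (D.fullBag t).ncard ≤ k + 1

/-- The directed tree width of `G`: the minimum width of an arboreal decomposition. -/
noncomputable def directedTreeWidth (G : FinDigraph) : ℕ :=
  sInf {k | HasArborealDecompositionOfWidth G.graph k}

/-! ### Both minima are attained -/

lemma isArborescence_unit : IsArborescence (⊥ : Digraph Unit) () where
  root_source _ h := h
  parent_unique _ _ _ _ _ := rfl
  reachable _ := ReflTransGen.refl

lemma hasDDecompositionOfWidth_dWidth (G : FinDigraph) :
    HasDDecompositionOfWidth G.graph (dWidth G) := by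
  refine Nat.sInf_mem (s := {k | HasDDecompositionOfWidth G.graph k})
    ⟨(univ : Set G.V).ncard, Unit, inferInstance,
      ⟨⊥, (), isArborescence_unit, fun _ => univ, iUnion_const _, ?_⟩, fun _ => le_rfl⟩
  rintro S ⟨⟨v, hv⟩, -⟩
  have : Nonempty {t : Unit | ((univ : Set G.V) ∩ S).Nonempty} := ⟨⟨(), v, trivial, hv⟩⟩
  exact ⟨fun a b => by rw [Subsingleton.elim a b]⟩

lemma hasArborealDecompositionOfWidth_directedTreeWidth (G : FinDigraph) :
    HasArborealDecompositionOfWidth G.graph (directedTreeWidth G) := by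
  have := G.nonempty
  refine Nat.sInf_mem (s := {k | HasArborealDecompositionOfWidth G.graph k})
    ⟨(univ : Set G.V).ncard, Unit, inferInstance,
      ⟨⊥, (), isArborescence_unit, fun _ => univ, fun _ _ => ∅, fun _ => univ_nonempty,
        fun a b h => (h (Subsingleton.elim a b)).elim, iUnion_const _, fun _ _ h => h.elim⟩,
      fun _ => ?_⟩
  simp [ArborealDecomposition.fullBag]

end DigraphWidth

namespace DigraphWidth

open Set Relation

/-! ### Words -/

/-! Words form a tree that is cut into gadgets. The subtree hanging from a gadget root can be
entered from outside only through its dock and its portal, while every word jumps back to all gadget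
roots above it. So the guard `{s, gate s, portal s, dock s}` works for every tree edge leaving `s`:
a walk that leaves the subtree of a child of `s` also leaves the subtree of `gate s` and cannot
re-enter it. With singleton bags this gives directed tree width at most 5
(`directedTreeWidth_portalGraph_le`).

For D-width, suppose all bags have at most `k` words. Below a gadget root `w`, extend a path by `k +
1` letters, choosing copies so that the topmost nodes descend (`exists_path`). Some passed word `x`
is missing from the bag of the current node `m`, hence occurs nowhere below `m`. Open a gadget `w'`
with portal `x`, again choosing a copy missing at `m`. For `v = w`, and for each earlier gadget root
`v` recorded, there is a closed walk from `w'` to `v`, then through lost words to `x`, and back to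
`w'`. Its vertex set is strongly connected and occurs on both sides of the edge entering `m`, so it
meets the bag of `m`, and only `v` can do so. Thus all recorded roots persist in the bag and each
round adds one (`exists_nested`); `k + 1` rounds are too many. -/

/-- Letters: `(none, c)` prolongs the current gadget, `(some l, c)` opens a new gadget; `c` counts
copies. -/
abbrev Letter (n : ℕ) := Option (Fin n) × Fin n

/-- Words are the nodes of a rooted tree in which the parent of a word is its tail. -/
abbrev Word (n : ℕ) := List (Letter n)

/-- The root of the gadget that contains the given word. -/
def gate {n : ℕ} : Word n → Word n
  | [] => []
  | (none, _) :: w => gate w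
  | (some l, c) :: w => (some l, c) :: w

/-- The node below which the gadget of the given word is attached. -/
def dock {n : ℕ} (w : Word n) : Word n := (gate w).tail

open Classical in
/-- The portal of the gadget with root `w`: the node of the parent gadget that is `l` steps above
the parent of `w`, where `l` is given by the last letter of `w`. -/
noncomputable def rootPortal {n : ℕ} : Word n → Word n
  | [] => []
  | (none, _) :: w => w
  | (some l, _) :: w => if gate w <:+ w.drop l then w.drop l else w

/-- The node besides the dock that has edges into the gadget of the given word. -/
noncomputable def portal {n : ℕ} (w : Word n) : Word n := rootPortal (gate w)

lemma suffix_tail_of_ne {α : Type*} {u w : List α} (h : u <:+ w) (hne : u ≠ w) : u <:+ w.tail := by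
  cases w with
  | nil => simpa using h
  | cons a w => exact (List.suffix_cons_iff.1 h).resolve_left hne

lemma suffix_antisymm {α : Type*} {u w : List α} (h : u <:+ w) (h' : w <:+ u) : u = w :=
  h.eq_of_length (le_antisymm h.length_le h'.length_le)

variable {n : ℕ}

lemma gate_suffix (w : Word n) : gate w <:+ w := by
  induction w with
  | nil => exact List.suffix_rfl
  | cons a w ih =>
    obtain ⟨_ | l, c⟩ := a
    · exact ih.trans (List.suffix_cons _ _)
    · exact List.suffix_rfl

lemma gate_gate (w : Word n) : gate (gate w) = gate w := by
  induction w with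
  | nil => rfl
  | cons a w ih =>
    obtain ⟨_ | l, c⟩ := a
    · exact ih
    · rfl

/-- Among the suffixes of `w`, `gate w` is the longest one fixed by `gate`. -/
lemma suffix_gate {u w : Word n} (hu : gate u = u) (h : u <:+ w) : u <:+ gate w := by
  induction w with
  | nil => exact h
  | cons a w ih =>
    obtain ⟨_ | l, c⟩ := a
    · rcases List.suffix_cons_iff.1 h with rfl | h
      · rw [hu]
      · exact ih h
    · exact h

lemma gate_eq_of_suffix {u w : Word n} (h : gate w <:+ u) (h' : u <:+ w) : gate u = gate w :=
  suffix_antisymm (suffix_gate (gate_gate u) ((gate_suffix u).trans h'))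
    (suffix_gate (gate_gate w) h)

lemma gate_cons (a : Letter n) (w : Word n) : gate (a :: w) = a :: w ∨ gate (a :: w) = gate w := by
  obtain ⟨_ | l, c⟩ := a
  · exact Or.inr rfl
  · exact Or.inl rfl

lemma dock_suffix (w : Word n) : dock w <:+ w :=
  (List.tail_suffix _).trans (gate_suffix w)

lemma portal_suffix_dock (w : Word n) : portal w <:+ dock w := by
  unfold portal dock
  rcases gate w with _ | ⟨⟨_ | l, c⟩, y⟩
  · exact List.suffix_rfl
  · exact List.suffix_rfl
  · rw [rootPortal]
    split_ifs
    · exact List.drop_suffix _ _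
    · exact List.suffix_rfl

lemma portal_suffix (w : Word n) : portal w <:+ w := (portal_suffix_dock w).trans (dock_suffix w)

/-- The case distinction in `rootPortal` is there for this: a portal never leaves the parent gadget,
so nested gadgets give no new entrance to an outer one. -/
lemma gate_dock_suffix_portal (w : Word n) : gate (dock w) <:+ portal w := by
  unfold portal dock
  rcases gate w with _ | ⟨⟨_ | l, c⟩, y⟩
  · exact List.suffix_rfl
  · exact gate_suffix _
  · rw [rootPortal]
    split_ifs with h
    · exact h
    · exact gate_suffix _

lemma portal_congr {u w : Word n} (h : gate u = gate w) : portal u = portal w := by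
  rw [portal, portal, h]

/-! ### The digraphs -/

/-- The edges: tree edges in both directions, edges from each word to the roots of all gadgets
around it, and edges from the root of a gadget and from its portal to all words of the gadget. -/
def WordAdj (a b : Word n) : Prop :=
  a ≠ b ∧ (a.tail = b ∨ b.tail = a ∨ (gate b = b ∧ b <:+ a) ∨ a = gate b ∨ a = portal b)

/-- The digraph on all words. -/
def wordGraph (n : ℕ) : Digraph (Word n) := ⟨WordAdj⟩

/-- The finite digraph on the words of length at most `n * n`. -/
def portalGraph (n : ℕ) : FinDigraph where
  V := {w : Word n // w.length ≤ n * n}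
  finite := (List.finite_length_le (Letter n) (n * n)).to_subtype
  nonempty := ⟨⟨[], Nat.zero_le _⟩⟩
  graph := ⟨fun a b => WordAdj a.1 b.1⟩
  loopless _ h := h.1 rfl

/-! ### The arboreal decomposition -/

/-- The guard of the tree edges that leave `s`. -/
def guardSet (s : Word n) : Set (Word n) := {s, gate s, portal s, dock s}

lemma suffix_of_mem_guardSet {s z : Word n} (hz : z ∈ guardSet s) : z <:+ s := by
  rcases hz with rfl | rfl | rfl | rfl
  exacts [List.suffix_rfl, gate_suffix s, portal_suffix s, dock_suffix s]

/-- Outside the guard, edges from below `a :: s` stay there or leave the gadget of `s`. -/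
lemma WordAdj.below_or_outside {l : Letter n} {s a b : Word n} (h : WordAdj a b)
    (hb : b ∉ guardSet s) (has : l :: s <:+ a) : l :: s <:+ b ∨ ¬ gate s <:+ b := by
  obtain ⟨-, rfl | rfl | ⟨hg, hba⟩ | rfl | rfl⟩ := h
  · rcases eq_or_ne (l :: s) a with rfl | hne
    · exact (hb (Or.inl rfl)).elim
    · exact Or.inl (suffix_tail_of_ne has hne)
  · exact Or.inl (has.trans (List.tail_suffix _))
  · rcases List.suffix_or_suffix_of_suffix has hba with h | h
    · exact Or.inl h
    · rcases List.suffix_cons_iff.1 h with rfl | h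
      · exact Or.inl List.suffix_rfl
      -- A jump to a gadget root `b` above `s` that stayed in the subtree of `gate s` would hit
      -- `gate s` itself, which is guarded.
      · exact Or.inr fun h' => hb (Or.inr (Or.inl (suffix_antisymm (suffix_gate hg h) h')))
  · exact Or.inl (has.trans (gate_suffix _))
  · exact Or.inl (has.trans (portal_suffix _))

/-- Outside the guard, no edge enters the gadget of `s`. -/
lemma WordAdj.outside {s a b : Word n} (h : WordAdj a b)
    (ha : a ∉ guardSet s) (has : ¬ gate s <:+ a) : ¬ gate s <:+ b := by
  intro hbs
  obtain ⟨-, rfl | rfl | ⟨hg, hba⟩ | rfl | rfl⟩ := h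
  · exact has (hbs.trans (List.tail_suffix _))
  · rcases eq_or_ne (gate s) b with rfl | hne
    · exact ha (Or.inr (Or.inr (Or.inr rfl)))
    · exact has (suffix_tail_of_ne hbs hne)
  · exact has (hbs.trans hba)
  · exact has (suffix_gate (gate_gate s) hbs)
  · have h1 := suffix_gate (gate_gate s) hbs
    -- Either `b` is in the gadget of `s`, so `a` is the guarded portal, or `b` is in a deeper
    -- gadget, whose portal is already below `gate s`.
    rcases eq_or_ne (gate s) (gate b) with he | hne
    · exact ha (Or.inr (Or.inr (Or.inl (portal_congr he.symm))))
    · exact has ((suffix_gate (gate_gate s) (suffix_tail_of_ne h1 hne)).trans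
        (gate_dock_suffix_portal b))

/-- The tree of words. -/
def wordTree (n : ℕ) : Digraph (portalGraph n).V := ⟨fun s t => ∃ l, t.1 = l :: s.1⟩

lemma reach_wordTree_iff {s t : (portalGraph n).V} :
    ReflTransGen (wordTree n).Adj s t ↔ s.1 <:+ t.1 := by
  constructor
  · intro h
    induction h with
    | refl => exact List.suffix_rfl
    | tail _ h ih =>
      obtain ⟨l, h⟩ := h
      exact ih.trans (h ▸ List.suffix_cons _ _)
  · obtain ⟨t, ht⟩ := t
    induction t with
    | nil =>
      intro h
      rw [show s = ⟨[], ht⟩ from Subtype.ext (List.suffix_nil.1 h)]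
      exact .refl
    | cons l t ih =>
      intro h
      rcases List.suffix_cons_iff.1 h with h | h
      · rw [show s = ⟨l :: t, ht⟩ from Subtype.ext h]
        exact .refl
      · exact (ih ((Nat.le_succ _).trans ht) h).tail ⟨l, rfl⟩

lemma isArborescence_wordTree (n : ℕ) :
    IsArborescence (wordTree n) (⟨[], Nat.zero_le _⟩ : {w : Word n // w.length ≤ n * n}) where
  root_source := by rintro s ⟨l, h⟩; cases h
  parent_unique := by
    rintro s s' t ⟨l, h⟩ ⟨l', h'⟩
    exact Subtype.ext (List.cons.inj (h.symm.trans h')).2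
  reachable t := reach_wordTree_iff.2 List.nil_suffix

/-- The arboreal decomposition along the tree of words. -/
def wordDecomposition (n : ℕ) : ArborealDecomposition (portalGraph n).graph (portalGraph n).V where
  tree := wordTree n
  root := ⟨[], Nat.zero_le _⟩
  isArborescence := isArborescence_wordTree n
  bag t := {t}
  guard s _ := {z | z.1 ∈ guardSet s.1}
  bag_nonempty _ := singleton_nonempty _
  bag_disjoint _ _ h := disjoint_singleton.2 h
  cover := by ext; simp
  normal := by
    rintro s t ⟨l, ht⟩
    have hmem : ∀ z, z ∈ (⋃ q ∈ {q | ReflTransGen (wordTree n).Adj t q}, ({q} : Set _)) ↔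
        l :: s.1 <:+ z.1 := by
      intro z
      simp [reach_wordTree_iff, ht]
    refine ⟨Set.disjoint_left.2 fun z hz hz' => ?_, fun u hu w hw v hvZ huv hvw => ?_⟩
    · have h1 := ((hmem z).1 hz).length_le
      have h2 := (suffix_of_mem_guardSet hz').length_le
      simp only [List.length_cons] at h1
      omega
    · rw [hmem] at hu hw ⊢
      have key : l :: s.1 <:+ v.1 ∨ ¬ gate s.1 <:+ v.1 := by
        clear hvw hvZ
        induction huv with
        | refl => exact Or.inl hu
        | tail _ h ih =>
          rcases ih with ih | ih
          · exact h.1.below_or_outside h.2.2 ih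
          · exact Or.inr (h.1.outside h.2.1 ih)
      refine key.resolve_right fun hv => ?_
      have : ¬ gate s.1 <:+ w.1 := by
        clear hw
        induction hvw with
        | refl => exact hv
        | tail _ h ih => exact h.1.outside h.2.1 ih
      exact this (((gate_suffix _).trans (List.suffix_cons _ _)).trans hw)

/-- The two guards at `t` overlap: `gate t` is `t` or the gate of its tail, and `dock t` is the tail
or the dock of the tail. Only six words remain. -/
lemma fullBag_wordDecomposition_subset (t : (portalGraph n).V) :
    Subtype.val '' (wordDecomposition n).fullBag t ⊆
      {t.1, t.1.tail, gate t.1.tail, portal t.1.tail, dock t.1.tail, portal t.1} := by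
  rintro _ ⟨z, (hz | hz) | hz, rfl⟩
  · exact Or.inl (congrArg Subtype.val hz)
  · obtain ⟨s, ⟨l, hs⟩, hz⟩ := mem_iUnion₂.1 hz
    change z.1 ∈ guardSet s.1 at hz
    rw [show s.1 = t.1.tail by rw [hs]; rfl] at hz
    rcases hz with h | h | h | (h : z.1 = _) <;> simp [h]
  · obtain ⟨s, -, hz⟩ := mem_iUnion₂.1 hz
    change z.1 ∈ guardSet t.1 at hz
    rcases hz with h | h | h | h
    · simp [h]
    · rw [h]
      rcases t.1 with _ | ⟨a, w⟩
      · exact Or.inl rfl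
      · rcases gate_cons a w with h | h <;> rw [h] <;> simp
    · simp [h]
    · rw [h]
      rcases t.1 with _ | ⟨a, w⟩
      · exact Or.inl rfl
      · unfold dock
        rcases gate_cons a w with h | h <;> rw [h] <;> simp

lemma directedTreeWidth_portalGraph_le (n : ℕ) : directedTreeWidth (portalGraph n) ≤ 5 := by
  classical
  refine Nat.sInf_le ⟨_, (portalGraph n).finite, wordDecomposition n, fun t => ?_⟩
  rw [← ncard_image_of_injective ((wordDecomposition n).fullBag t) Subtype.val_injective]
  refine (ncard_le_ncard (fullBag_wordDecomposition_subset t) (toFinite _)).trans ?_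
  have := Finset.card_le_six (a := t.1) (b := t.1.tail) (c := gate t.1.tail)
    (d := portal t.1.tail) (e := dock t.1.tail) (f := portal t.1)
  rw [← ncard_coe_finset] at this
  simpa using this

/-! ### Arborescences -/

namespace IsArborescence

variable {T : Type*} {A : Digraph T} {r : T}

/-- A cycle through a node passes through its unique parent, so cycles propagate up to the root,
which has no incoming edge. -/
lemma not_transGen_self (hA : IsArborescence A r) (t : T) : ¬ TransGen A.Adj t t := by
  induction hA.reachable t with
  | refl =>
    intro h
    obtain ⟨s, -, hs⟩ := TransGen.tail'_iff.1 h
    exact hA.root_source s hs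
  | @tail s t _ hst ih =>
    intro h
    obtain ⟨s', h, hs'⟩ := TransGen.tail'_iff.1 h
    obtain rfl := hA.parent_unique _ _ _ hst hs'
    exact ih (TransGen.head' hst h)

lemma reach_antisymm (hA : IsArborescence A r) {s t : T} (h : ReflTransGen A.Adj s t)
    (h' : ReflTransGen A.Adj t s) : s = t := by
  rcases reflTransGen_iff_eq_or_transGen.1 h with rfl | h
  · rfl
  · exact (hA.not_transGen_self s (h.trans_left h')).elim

lemma not_reach_parent (hA : IsArborescence A r) {p m : T} (h : A.Adj p m) :
    ¬ ReflTransGen A.Adj m p :=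
  fun h' => hA.not_transGen_self p (TransGen.head' h h')

/-- A connected set of nodes that meets the part below `m` and its complement contains both ends of
the edge that enters `m`. -/
lemma crossing (hA : IsArborescence A r) {N : Set T}
    (hN : (A.toSimpleGraphInclusive.induce N).Connected) {m q q' : T} (hq : q ∈ N) (hq' : q' ∈ N)
    (hmq : ReflTransGen A.Adj m q) (hmq' : ¬ ReflTransGen A.Adj m q') :
    m ∈ N ∧ ∃ p ∈ N, A.Adj p m := by
  obtain ⟨P⟩ := hN.preconnected ⟨q, hq⟩ ⟨q', hq'⟩
  obtain ⟨d, -, h1, h2⟩ := P.exists_boundary_dart {x | ReflTransGen A.Adj m x.1} hmq hmq'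
  obtain ⟨⟨⟨a, ha⟩, ⟨b, hb⟩⟩, hab⟩ := d
  change ReflTransGen A.Adj m a at h1
  change ¬ ReflTransGen A.Adj m b at h2
  have hab' : a ≠ b ∧ (A.Adj a b ∨ A.Adj b a) := hab
  rcases hab'.2 with h | h
  · exact (h2 (h1.tail h)).elim
  · rcases ReflTransGen.cases_tail h1 with rfl | ⟨c, hc, hca⟩
    · exact ⟨ha, b, hb, h⟩
    · obtain rfl := hA.parent_unique _ _ _ h hca
      exact (h2 hc).elim

/-- A connected set of nodes has a topmost node. -/
lemma exists_top [Finite T] (hA : IsArborescence A r) {N : Set T}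
    (hN : (A.toSimpleGraphInclusive.induce N).Connected) :
    ∃ m ∈ N, ∀ t ∈ N, ReflTransGen A.Adj m t := by
  obtain ⟨⟨x, hx⟩⟩ := hN.nonempty
  -- Take `m` with an inclusion-maximal set of descendants; if it missed a node of `N`, its parent
  -- would lie in `N` and have more descendants.
  obtain ⟨m, hm, hmax⟩ := N.toFinite.exists_maximalFor
    (fun m => {t | ReflTransGen A.Adj m t}) N ⟨x, hx⟩
  refine ⟨m, hm, fun t ht => by_contra fun hmt => ?_⟩
  obtain ⟨-, p, hp, hpm⟩ := hA.crossing hN hm ht ReflTransGen.refl hmt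
  have h := hmax hp fun t ht => ReflTransGen.head hpm ht
  exact hA.not_reach_parent hpm (h ReflTransGen.refl)

end IsArborescence

lemma stronglyConnectedSet_singleton {V : Type*} (G : Digraph V) (v : V) :
    StronglyConnectedSet G {v} :=
  ⟨singleton_nonempty v, by rintro _ rfl _ rfl; exact ReflTransGen.refl⟩

lemma stronglyConnectedSet_pair {V : Type*} {G : Digraph V} {v w : V} (h : G.Adj v w)
    (h' : G.Adj w v) : StronglyConnectedSet G {v, w} := by
  have hv : v ∈ ({v, w} : Set V) := Or.inl rfl
  have hw : w ∈ ({v, w} : Set V) := Or.inr rfl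
  refine ⟨⟨v, hv⟩, ?_⟩
  rintro _ (rfl | rfl) _ (rfl | rfl)
  exacts [.refl, .single ⟨h, hv, hw⟩, .single ⟨h', hw, hv⟩, .refl]

lemma ReachIn.mono {V : Type*} {G : Digraph V} {S S' : Set V} (h : S ⊆ S') {v w : V}
    (hvw : ReachIn G S v w) : ReachIn G S' v w :=
  ReflTransGen.mono (fun _ _ h' => ⟨h'.1, h h'.2.1, h h'.2.2⟩) _ _ hvw

/-! ### Tree decompositions of the digraph of words -/

/-- A D-decomposition of the digraph on the words of length at most `N`, with bags of size at most
`k`. -/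
structure WordDecomposition (n N k : ℕ) (T : Type*) where
  tree : Digraph T
  root : T
  isArborescence : IsArborescence tree root
  bag : T → Set (Word n)
  finite_bag : ∀ t, (bag t).Finite
  ncard_bag_le : ∀ t, (bag t).ncard ≤ k
  connected : ∀ S : Set (Word n), (∀ w ∈ S, w.length ≤ N) → StronglyConnectedSet (wordGraph n) S →
    (tree.toSimpleGraphInclusive.induce {t | (bag t ∩ S).Nonempty}).Connected

namespace WordDecomposition

variable {N k : ℕ} {T : Type*} (D : WordDecomposition n N k T)

/-- `t` lies below `m`. -/
abbrev Below (m t : T) : Prop := ReflTransGen D.tree.Adj m t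

lemma nonempty_nodes {w : Word n} (hw : w.length ≤ N) : ∃ t, w ∈ D.bag t := by
  obtain ⟨⟨t, x, hx, rfl⟩⟩ := (D.connected {w} (by rintro _ rfl; exact hw)
    (stronglyConnectedSet_singleton _ _)).nonempty
  exact ⟨t, hx⟩

lemma exists_top [Finite T] {w : Word n} (hw : w.length ≤ N) :
    ∃ m, w ∈ D.bag m ∧ ∀ t, w ∈ D.bag t → D.Below m t := by
  obtain ⟨m, ⟨x, hx, rfl⟩, h⟩ := D.isArborescence.exists_top
    (D.connected {w} (by rintro _ rfl; exact hw) (stronglyConnectedSet_singleton _ _))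
  exact ⟨m, hx, fun t ht => h t ⟨x, ht, rfl⟩⟩

/-- The words in the bag of `m` or in the bag of its parent. -/
def blocked (m : T) : Set (Word n) := D.bag m ∪ ⋃ p ∈ {p | D.tree.Adj p m}, D.bag p

lemma blocked_subset (m : T) : ∃ p, D.blocked m ⊆ D.bag m ∪ D.bag p := by
  by_cases h : ∃ p, D.tree.Adj p m
  · obtain ⟨p, hp⟩ := h
    refine ⟨p, union_subset_union_right _ (iUnion₂_subset fun q hq => ?_)⟩
    rw [D.isArborescence.parent_unique q p m hq hp]
  · refine ⟨m, union_subset_union_right _ (iUnion₂_subset fun q hq => ?_)⟩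
    exact (h ⟨q, hq⟩).elim

/-- Among the letters with given first part, one leads to an unblocked child. -/
lemma exists_not_mem_blocked (hn : 2 * k < n) (m : T) (o : Option (Fin n)) (w : Word n) :
    ∃ c, (o, c) :: w ∉ D.blocked m := by
  by_contra! h
  obtain ⟨p, hp⟩ := D.blocked_subset m
  have hinj : Function.Injective fun c : Fin n => ((o, c) :: w : Word n) := by
    intro c d hcd
    simpa using hcd
  have h1 : (range fun c : Fin n => ((o, c) :: w : Word n)) ⊆ D.bag m ∪ D.bag p := by
    rintro _ ⟨c, rfl⟩
    exact hp (h c)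
  have h2 := ncard_le_ncard h1 ((D.finite_bag m).union (D.finite_bag p))
  rw [← image_univ, ncard_image_of_injective _ hinj, ncard_univ, Nat.card_fin] at h2
  have h3 := ncard_union_le (D.bag m) (D.bag p)
  have h4 := D.ncard_bag_le m
  have h5 := D.ncard_bag_le p
  omega

/-- If `m` is the topmost node of `y`, then an unblocked child of `y` lies strictly below `m`. -/
lemma below_of_not_mem_blocked {m : T} {y : Word n} {a : Letter n} (hlen : y.length < N)
    (hym : y ∈ D.bag m) (hy : ∀ t, y ∈ D.bag t → D.Below m t) (ha : a :: y ∉ D.blocked m) {t : T}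
    (ht : a :: y ∈ D.bag t) : D.Below m t := by
  by_contra hmt
  have hne : y ≠ a :: y := (List.cons_ne_self a y).symm
  have hconn := D.connected {y, a :: y}
    (by rintro _ (rfl | rfl); exacts [hlen.le, hlen])
    (stronglyConnectedSet_pair (G := wordGraph n) ⟨hne, Or.inr (Or.inl rfl)⟩
      ⟨hne.symm, Or.inl rfl⟩)
  -- The pair would have to meet the bag of the parent `p`: `y` is absent there because `m` is
  -- topmost, and `a :: y` because it is unblocked.
  obtain ⟨-, p, ⟨x, hx, rfl | rfl⟩, hpm⟩ := D.isArborescence.crossing hconn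
    (m := m) ⟨y, hym, Or.inl rfl⟩ ⟨_, ht, Or.inr rfl⟩ ReflTransGen.refl hmt
  · exact D.isArborescence.not_reach_parent hpm (hy p hx)
  · exact ha (Or.inr (mem_iUnion₂.2 ⟨p, hpm, hx⟩))

/-- Following a path of words below the gadget root `w`: the topmost nodes descend, and each word
that was passed occurs somewhere not below the current node. -/
lemma exists_path [Finite T] (hn : 2 * k < n) {w : Word n} (hw : gate w = w) {t : T}
    (hwt : ∀ q, w ∈ D.bag q → D.Below t q) (d : ℕ) (hlen : w.length + d ≤ N) :
    ∃ (y : Word n) (m : T), y.length = w.length + d ∧ y.drop d = w ∧ gate y = w ∧ D.Below t m ∧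
      y ∈ D.bag m ∧ (∀ q, y ∈ D.bag q → D.Below m q) ∧
      ∀ i, 1 ≤ i → i ≤ d → ∃ q, y.drop i ∈ D.bag q ∧ ¬ D.Below m q := by
  induction d with
  | zero =>
    obtain ⟨m, hm, hm'⟩ := D.exists_top (w := w) (by omega)
    exact ⟨w, m, rfl, rfl, hw, hwt m hm, hm, hm', fun i h1 h2 => by omega⟩
  | succ d ih =>
    obtain ⟨y, m, hy, hdrop, hgate, htm, hym, hmy, hpass⟩ := ih (by omega)
    obtain ⟨c, hc⟩ := D.exists_not_mem_blocked hn m none y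
    obtain ⟨m', hm', htop⟩ := D.exists_top (w := (none, c) :: y) (by simp; omega)
    have hmm' : D.Below m m' := D.below_of_not_mem_blocked (by omega) hym hmy hc hm'
    have hnot : ¬ D.Below m' m := by
      intro h
      rw [← D.isArborescence.reach_antisymm hmm' h] at hm'
      exact hc (Or.inl hm')
    refine ⟨(none, c) :: y, m', by simp; omega, hdrop, hgate, htm.trans hmm', hm', htop, ?_⟩
    rintro (_ | _ | i) h1 h2
    · omega
    · exact ⟨m, hym, hnot⟩
    · obtain ⟨q, hq, hmq⟩ := hpass (i + 1) (by omega) (by omega)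
      exact ⟨q, hq, fun h => hmq (hmm'.trans h)⟩

/-- The word `x` occurs in no bag below `t`. -/
def Lost (t : T) (x : Word n) : Prop := ∀ q, D.Below t q → x ∉ D.bag q

/-- A word which occurs outside the part below `m`, but not at `m`, is lost. -/
lemma lost_of_not_mem {m q : T} {x : Word n} (hx : x.length ≤ N) (hq : x ∈ D.bag q)
    (hmq : ¬ D.Below m q) (hm : x ∉ D.bag m) : D.Lost m x := by
  intro q' hmq' hq'
  have hconn := D.connected {x} (by rintro _ rfl; exact hx) (stronglyConnectedSet_singleton _ _)
  obtain ⟨⟨_, h, rfl⟩, -⟩ := D.isArborescence.crossing hconn (m := m)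
    ⟨x, hq', rfl⟩ ⟨x, hq, rfl⟩ hmq' hmq
  exact hm h

/-- From the gadget root `v` one can return to the gadget of `w` through lost words. -/
def Returns (t : T) (w v : Word n) : Prop :=
  ∃ L : Set (Word n), (∀ x ∈ L, D.Lost t x ∧ x.length ≤ N) ∧ portal w ∈ L ∧
    ∀ y ∈ insert v L, ReachIn (wordGraph n) (insert v L) v y ∧
      ReachIn (wordGraph n) (insert v L) y (portal w)

/-- If one can return from `v`, then `v` is in the bag. -/
lemma mem_bag_of_returns {t : T} {w v : Word n} (hw : w.length ≤ N) (hgw : gate w = w)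
    (hwt : ∀ q, w ∈ D.bag q → D.Below t q) (hwm : w ∉ D.bag t) (hgv : gate v = v) (hvw : v <:+ w)
    (hne : v ≠ w) (h : D.Returns t w v) : v ∈ D.bag t := by
  obtain ⟨L, hL, hp, hreach⟩ := h
  set S : Set (Word n) := insert w (insert v L) with hS
  have hsub : insert v L ⊆ S := subset_insert _ _
  have hwS : w ∈ S := mem_insert _ _
  have hvS : v ∈ S := hsub (mem_insert _ _)
  have hpS : portal w ∈ S := hsub (mem_insert_of_mem _ hp)
  have h1 : ReachIn (wordGraph n) S w v :=
    .single ⟨⟨hne.symm, Or.inr (Or.inr (Or.inl ⟨hgv, hvw⟩))⟩, hwS, hvS⟩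
  have h2 : ReachIn (wordGraph n) S (portal w) w := by
    by_cases hpw : portal w = w
    · rw [hpw]; exact .refl
    · exact .single ⟨⟨hpw, Or.inr (Or.inr (Or.inr (Or.inr rfl)))⟩, hpS, hwS⟩
  have hfrom : ∀ y ∈ S, ReachIn (wordGraph n) S w y := by
    rintro y (rfl | hy)
    · exact .refl
    · exact h1.trans ((hreach y hy).1.mono hsub)
  have hto : ∀ y ∈ S, ReachIn (wordGraph n) S y w := by
    rintro y (rfl | hy)
    · exact .refl
    · exact ((hreach y hy).2.mono hsub).trans h2
  have hlen : ∀ y ∈ S, y.length ≤ N := by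
    rintro y (rfl | rfl | hy)
    exacts [hw, hvw.length_le.trans hw, (hL y hy).2]
  have hconn := D.connected S hlen ⟨⟨w, hwS⟩, fun y hy z hz => (hto y hy).trans (hfrom z hz)⟩
  obtain ⟨q, hq⟩ := D.nonempty_nodes hw
  obtain ⟨q', hq'⟩ := D.nonempty_nodes (hL _ hp).2
  -- `w` occurs only below `t` and the lost portal only elsewhere, so `S` meets the bag of `t`; `w`
  -- and the lost words are absent from it.
  obtain ⟨⟨x, hx, rfl | rfl | hxL⟩, -⟩ := D.isArborescence.crossing hconn (m := t)
    ⟨w, hq, hwS⟩ ⟨_, hq', hpS⟩ (hwt q hq) fun h => (hL _ hp).1 q' h hq'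
  · exact (hwm hx).elim
  · exact hx
  · exact ((hL x hxL).1 t ReflTransGen.refl hx).elim

/-- Opening a new gadget keeps the possibility to return. -/
lemma Returns.extend {t m : T} {w v x w' : Word n} (htm : D.Below t m) (hx : D.Lost m x)
    (hxl : x.length ≤ N) (hgx : gate x = w) (hgw : gate w = w) (hpw : portal w' = x)
    (h : D.Returns t w v) : D.Returns m w' v := by
  obtain ⟨L, hL, hp, hreach⟩ := h
  have hpx : portal x = portal w := portal_congr (hgx.trans hgw.symm)
  have hsub : insert v L ⊆ insert v (insert x L) := insert_subset_insert (subset_insert _ _)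
  have hstep : ReachIn (wordGraph n) (insert v (insert x L)) (portal w) x := by
    by_cases h : portal w = x
    · rw [h]; exact .refl
    · exact .single ⟨⟨h, Or.inr (Or.inr (Or.inr (Or.inr hpx.symm)))⟩,
        Or.inr (Or.inr hp), Or.inr (Or.inl rfl)⟩
  have key : ∀ y ∈ insert v L, ReachIn (wordGraph n) (insert v (insert x L)) v y ∧
      ReachIn (wordGraph n) (insert v (insert x L)) y x := fun y hy =>
    ⟨(hreach y hy).1.mono hsub, ((hreach y hy).2.mono hsub).trans hstep⟩
  refine ⟨insert x L, ?_, Or.inl hpw, ?_⟩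
  · rintro y (rfl | hy)
    · exact ⟨hx, hxl⟩
    · exact ⟨fun q hq => (hL y hy).1 q (htm.trans hq), (hL y hy).2⟩
  · rw [hpw]
    rintro y (rfl | rfl | hy)
    · exact key _ (Or.inl rfl)
    · exact ⟨(key v (Or.inl rfl)).2, .refl⟩
    · exact key y (Or.inr hy)

/-- Starts the record for the newest root `w`: a gadget root has an edge to every word of its
gadget, in particular to the lost word `x`. -/
lemma returns_of_portal {m : T} {w x w' : Word n} (hx : D.Lost m x)
    (hxl : x.length ≤ N) (hgx : gate x = w) (hpw : portal w' = x) : D.Returns m w' w := by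
  have hstep : ReachIn (wordGraph n) {w, x} w x := by
    by_cases h : w = x
    · rw [h]; exact .refl
    · exact .single ⟨⟨h, Or.inr (Or.inr (Or.inr (Or.inl hgx.symm)))⟩, Or.inl rfl, Or.inr rfl⟩
  refine ⟨{x}, ?_, hpw, ?_⟩
  · rintro _ rfl
    exact ⟨hx, hxl⟩
  · rw [hpw]
    rintro y (rfl | rfl)
    · exact ⟨.refl, hstep⟩
    · exact ⟨hstep, .refl⟩

/-- Some bag contains the roots of `s` nested gadgets. -/
lemma exists_nested [Finite T] (hn : 2 * k < n) (hkn : k + 1 < n) (s : ℕ)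
    (hs : s * (k + 2) ≤ N) :
    ∃ (w : Word n) (t : T) (A : Finset (Word n)), w.length = s * (k + 2) ∧ gate w = w ∧
      (∀ q, w ∈ D.bag q → D.Below t q) ∧ A.card = s ∧
      ∀ v ∈ A, v ∈ D.bag t ∧ gate v = v ∧ v <:+ w ∧ v ≠ w ∧ D.Returns t w v := by
  classical
  induction s with
  | zero =>
    exact ⟨[], D.root, ∅, by simp, rfl, fun q _ => D.isArborescence.reachable q, rfl, by simp⟩
  | succ s ih =>
    rw [add_mul, one_mul] at hs ⊢
    obtain ⟨w, t, A, hwl, hgw, hwt, hA, hAv⟩ := ih (by omega)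
    obtain ⟨y, m, hyl, hyd, hgy, htm, hym, hmy, hpass⟩ :=
      D.exists_path hn hgw hwt (k + 1) (by omega)
    -- The `k + 1` passed words have distinct lengths and cannot all fit in one bag.
    obtain ⟨i, hi1, hi2, hi⟩ : ∃ i, 1 ≤ i ∧ i ≤ k + 1 ∧ y.drop i ∉ D.bag m := by
      by_contra! h
      have hsub : ((Finset.Icc 1 (k + 1)).image fun i => y.drop i : Set (Word n)) ⊆ D.bag m := by
        intro x hx
        obtain ⟨i, hi, rfl⟩ := Finset.mem_image.1 hx
        rw [Finset.mem_Icc] at hi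
        exact h i hi.1 hi.2
      have h1 := ncard_le_ncard hsub (D.finite_bag m)
      rw [ncard_coe_finset, Finset.card_image_of_injOn, Nat.card_Icc] at h1
      · have := D.ncard_bag_le m
        omega
      · intro a ha b hb hab
        have := congrArg List.length hab
        simp only [Finset.coe_Icc, mem_Icc, List.length_drop] at ha hb this
        omega
    have hxl : (y.drop i).length ≤ N := (List.drop_suffix i y).length_le.trans (by omega)
    have hlost : D.Lost m (y.drop i) := by
      obtain ⟨q, hq, hmq⟩ := hpass i hi1 hi2
      exact D.lost_of_not_mem hxl hq hmq hi
    have hwx : gate y <:+ y.drop i := by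
      rw [hgy, ← hyd]
      exact List.drop_suffix_drop_left y hi2
    have hgx : gate (y.drop i) = w := (gate_eq_of_suffix hwx (List.drop_suffix i y)).trans hgy
    -- The letter `some i` makes `y.drop i` the portal; `i ≤ k + 1 < n` makes it a legal letter.
    obtain ⟨c, hc⟩ := D.exists_not_mem_blocked hn m (some ⟨i, by omega⟩) y
    set w' : Word n := (some ⟨i, by omega⟩, c) :: y with hw'
    have hpw : portal w' = y.drop i := if_pos hwx
    have hgw' : gate w' = w' := rfl
    have hwl' : w'.length = s * (k + 2) + (k + 2) := by
      rw [hw', List.length_cons]; omega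
    have hwt' : ∀ q, w' ∈ D.bag q → D.Below m q := fun q hq =>
      D.below_of_not_mem_blocked (by omega) hym hmy hc hq
    have hww' : w <:+ w' := (hgy ▸ gate_suffix y).trans (List.suffix_cons _ _)
    have hmem : ∀ v, gate v = v → v <:+ w → D.Returns m w' v →
        v ∈ D.bag m ∧ gate v = v ∧ v <:+ w' ∧ v ≠ w' ∧ D.Returns m w' v := by
      intro v hgv hvw hR
      have hne : v ≠ w' := by
        rintro rfl
        have := hvw.length_le
        omega
      exact ⟨D.mem_bag_of_returns (by omega) hgw' hwt' (fun h => hc (Or.inl h)) hgv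
        (hvw.trans hww') hne hR, hgv, hvw.trans hww', hne, hR⟩
    refine ⟨w', m, insert w A, hwl', hgw', hwt', ?_, ?_⟩
    · rw [Finset.card_insert_of_notMem (fun h => (hAv w h).2.2.2.1 rfl), hA]
    · intro v hv
      rcases Finset.mem_insert.1 hv with rfl | hv
      · exact hmem _ hgw List.suffix_rfl (D.returns_of_portal hlost hxl hgx hpw)
      · obtain ⟨-, hgv, hvw, -, hR⟩ := hAv v hv
        exact hmem v hgv hvw (hR.extend D htm hlost hxl hgx hgw hpw)

lemma false_of_large [Finite T] (D : WordDecomposition n N k T) (hn : 2 * k < n)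
    (hkn : k + 1 < n) (hN : (k + 1) * (k + 2) ≤ N) : False := by
  obtain ⟨w, t, A, -, -, -, hA, hAv⟩ := D.exists_nested hn hkn (k + 1) hN
  have h := ncard_le_ncard (s := (A : Set (Word n))) (fun v hv => (hAv v hv).1) (D.finite_bag t)
  rw [ncard_coe_finset, hA] at h
  have := D.ncard_bag_le t
  omega

end WordDecomposition

/-! ### Transfer to the finite digraphs and the lower bound on D-width -/

lemma stronglyConnectedSet_preimage {S : Set (Word n)} (hS : ∀ w ∈ S, w.length ≤ n * n)
    (h : StronglyConnectedSet (wordGraph n) S) :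
    StronglyConnectedSet (portalGraph n).graph {x | x.1 ∈ S} := by
  obtain ⟨⟨w, hw⟩, h⟩ := h
  refine ⟨⟨⟨w, hS w hw⟩, hw⟩, ?_⟩
  intro v hv w hw
  have key : ∀ b, ReachIn (wordGraph n) S v.1 b → ∀ hb : b ∈ S,
      ReachIn (portalGraph n).graph {x | x.1 ∈ S} v ⟨b, hS b hb⟩ := by
    intro b hvb
    induction hvb with
    | refl => exact fun _ => .refl
    | tail _ hab ih => exact fun hb => (ih hab.2.1).tail ⟨hab.1, hab.2.1, hb⟩
  exact key w.1 (h v.1 hv w.1 hw) hw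

/-- A D-decomposition of the finite digraph, as a decomposition of the digraph of all words. -/
def DDecomposition.toWordDecomposition {k : ℕ} {T : Type*}
    (D : DDecomposition (portalGraph n).graph T) (hD : ∀ t, (D.bag t).ncard ≤ k) :
    WordDecomposition n (n * n) k T where
  tree := D.tree
  root := D.root
  isArborescence := D.isArborescence
  bag t := Subtype.val '' D.bag t
  finite_bag t :=
    have := (portalGraph n).finite
    (toFinite (D.bag t)).image _
  ncard_bag_le t := (ncard_image_of_injective (D.bag t) Subtype.val_injective).trans_le (hD t)
  connected S hS hsc := by
    have heq : {t | (Subtype.val '' D.bag t ∩ S).Nonempty} =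
        {t | (D.bag t ∩ {x | x.1 ∈ S}).Nonempty} := by
      ext t
      constructor
      · rintro ⟨_, ⟨x, hx, rfl⟩, hxS⟩
        exact ⟨x, hx, hxS⟩
      · rintro ⟨x, hx, hxS⟩
        exact ⟨x.1, ⟨x, hx, rfl⟩, hxS⟩
    rw [heq]
    exact D.connected _ (stronglyConnectedSet_preimage hS hsc)

/-- For `n = 2 * k + 3`, there are more copies than words in two bags, `k + 1` is a legal portal
distance, and length `n * n` leaves room for `k + 1` rounds of `k + 2` letters. -/
lemma lt_dWidth_portalGraph (k : ℕ) : k < dWidth (portalGraph (2 * k + 3)) := by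
  by_contra! h
  obtain ⟨T, _, D, hD⟩ := hasDDecompositionOfWidth_dWidth (portalGraph (2 * k + 3))
  exact (D.toWordDecomposition fun t => (hD t).trans h).false_of_large (by omega) (by omega)
    (by nlinarith)

end DigraphWidth

theorem mainTheorem5 :
    (∃ 𝒢 : Set FinDigraph,
      (∃ c : ℕ, ∀ G ∈ 𝒢, DigraphWidth.directedTreeWidth G ≤ c) ∧
      (∀ k : ℕ, ∃ G ∈ 𝒢, k < DigraphWidth.dWidth G)) ∧
    (¬ ∃ f : ℕ → ℕ, ∀ G : FinDigraph, DigraphWidth.dWidth G ≤ f (DigraphWidth.directedTreeWidth G)) ∧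
    (∃ G : FinDigraph, DigraphWidth.directedTreeWidth G + 1 < DigraphWidth.dWidth G) := by
  refine ⟨⟨Set.range DigraphWidth.portalGraph, ⟨5, ?_⟩, fun k =>
    ⟨_, ⟨2 * k + 3, rfl⟩, DigraphWidth.lt_dWidth_portalGraph k⟩⟩, ?_, ?_⟩
  · rintro _ ⟨n, rfl⟩
    exact DigraphWidth.directedTreeWidth_portalGraph_le n
  · rintro ⟨f, hf⟩
    -- Since `f` need not be monotone, its maximum over all possible widths `0, ..., 5` is used.
    have h1 := DigraphWidth.lt_dWidth_portalGraph ((Finset.range 6).sup f)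
    have h2 := hf (DigraphWidth.portalGraph (2 * (Finset.range 6).sup f + 3))
    have h3 := DigraphWidth.directedTreeWidth_portalGraph_le (2 * (Finset.range 6).sup f + 3)
    have h4 := Finset.le_sup (f := f) (Finset.mem_range.2 (Nat.lt_of_le_of_lt h3 (by decide : 5 < 6)))
    omega
  · have h1 := DigraphWidth.lt_dWidth_portalGraph 6
    have h2 := DigraphWidth.directedTreeWidth_portalGraph_le (2 * 6 + 3)
    exact ⟨_, lt_of_le_of_lt (Nat.succ_le_succ h2) h1⟩
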